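/- **Setting.** Let $\sigma,\beta:\mathbb R\to\mathbb R$ be continuous with $\sigma>0$. A *mollifier* is a Schwartz function $\Phi$ with $\int\Phi=1$; put $\Phi_n(x)=n\Phi(nx)$, $\sigma_n^2=\sigma^2*\Phi_n$, $\beta_n=\beta*\Phi_n$ and $L_ng=\frac{\sigma_n^2}{2}g''+\beta_n'g'$. (If $\sigma$ or $\beta$ grows so fast that these regularisations do not make sense for every Schwartz function, only those $\Phi$ count as mollifiers for which the convolutions converge absolutely, $\sigma_n^2\in C^0$, $\beta_n\in C^1$, and $\sigma_n^2\to\sigma^2$, $\beta_n\to\beta$ uniformly on compacts. Compactly supported $\Phi$ always qualify, and all Schwartz $\Phi$ with $\int\Phi=1$ do when $\sigma,\beta$ have polynomial growth.) In $C^0(\mathbb R)$ and $C^1(\mathbb R)$ convergence means uniform convergence on compacts, of the functions and, in $C^1$, also of their first derivatives. For $f\in C^1(\mathbb R)$ and $l\in C^0(\mathbb R)$ we say that $f$ is a $C^1$-solution of $Lf=l$, where formally $Lf=\frac{\sigma^2}{2}f''+\beta'f'$, if for every mollifier there are $f_n\in C^2(\mathbb R)$ and $l_n\in C^0(\mathbb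 R)$ with $L_nf_n=l_n$, $f_n\to f$ in $C^1$ and $l_n\to l$ in $C^0$. Let $\mathcal D_L$ be the set of all $f\in C^1(\mathbb R)$ that are $C^1$-solutions of $Lf=l$ for some $l\in C^0(\mathbb R)$. Assume that the limit $$\Sigma(x)=\lim_{n\to\infty}2\int_0^x\frac{\beta_n'(y)}{\sigma_n^2(y)}\,dy$$ exists in $C^0(\mathbb R)$ and does not depend on the mollifier. A function $\Gamma:[0,1]\to\mathbb R$ is called a solution of $$L\Gamma=-1,\qquad \Gamma(0)=\Gamma(1)=0\qquad(\ast)$$ if it is the restriction to $[0,1]$ of some $\tilde\Gamma\in\mathcal D_L$ which is a $C^1$-solution of $L\tilde\Gamma=\tilde g$ for some continuous $\tilde g:\mathbb R\to\mathbb R$ with $\tilde g=-1$ on $[0,1]$, and $\tilde\Gamma(0)=\tilde\Gamma(1)=0$. A real-valued process $X=(X_t)_{t\ge0}$ with continuous paths, adapted to a filtration $\mathcal F$ on a probability space (for instance its canonical filtration), solves the martingale problem for $L$ started at $x$ if $X_0=x$ a.s. and $$f(X_t)-f(x)-\int_0^tLf(X_s)\,ds$$ is an $\mathcal F$-local martingale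 for every $f\in\mathcal D_L$. **Statement.** Problem $(\ast)$ has exactly one solution $\Gamma$. Let $x\in[0,1]$, let $X$ solve the martingale problem for $L$ started at $x$, and let $\tau=\inf\{t\ge0: X_t\notin[0,1]\}$, with $\inf\emptyset=\infty$. Then $\tau$ is measurable, $E(\tau)<\infty$, in particular $\tau<\infty$ almost surely, and $$E(\tau)=\Gamma(x).$$ -/

import Mathlib

open MeasureTheory ProbabilityTheory Filter Topology
open scoped NNReal ENNReal SchwartzMap Convolution

namespace DistDrift

noncomputable section

/-- The rescaled kernel `Φₙ(x) = n Φ(n x)`. -/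
def rescale (Φ : 𝓢(ℝ, ℝ)) (n : ℕ) (x : ℝ) : ℝ := n * Φ (n * x)

/-- The regularised squared diffusion coefficient `σₙ² = σ² ∗ Φₙ`. -/
def sigmaSq (σ : ℝ → ℝ) (Φ : 𝓢(ℝ, ℝ)) (n : ℕ) : ℝ → ℝ :=
  (fun x => σ x ^ 2) ⋆ rescale Φ n

/-- The regularised drift primitive `βₙ = β ∗ Φₙ`. -/
def betaReg (β : ℝ → ℝ) (Φ : 𝓢(ℝ, ℝ)) (n : ℕ) : ℝ → ℝ :=
  β ⋆ rescale Φ n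

/-- A mollifier for the pair `(σ, β)`: a Schwartz function of integral one for which the
regularisations `σₙ²`, `βₙ` make sense, i.e. the convolutions are given by absolutely convergent
integrals, are as smooth as needed for the operator `Lₙ`, and regularise `σ²` and `β`.
All the fields but `integral_eq_one` hold automatically for every Schwartz function of integral one
when the continuous functions `σ²` and `β` have polynomial growth, and for every compactly
supported one without any growth condition. They only exclude Schwartz functions
for which `σ² ∗ Φₙ` or `β ∗ Φₙ` is meaningless because `σ` or `β` grows too fast. -/
structure IsMollifier (σ β : ℝ → ℝ) (Φ : 𝓢(ℝ, ℝ)) : Prop where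
  integral_eq_one : ∫ x, Φ x = 1
  sigma_exists : ∀ n, ConvolutionExists (fun x => σ x ^ 2) (rescale Φ n)
    (ContinuousLinearMap.lsmul ℝ ℝ)
  beta_exists : ∀ n, ConvolutionExists β (rescale Φ n) (ContinuousLinearMap.lsmul ℝ ℝ)
  sigma_continuous : ∀ n, Continuous (sigmaSq σ Φ n)
  beta_contDiff : ∀ n, ContDiff ℝ 1 (betaReg β Φ n)
  sigma_tendsto : TendstoLocallyUniformly (sigmaSq σ Φ) (fun x => σ x ^ 2) atTop
  beta_tendsto : TendstoLocallyUniformly (betaReg β Φ) β atTop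

/-- The regularised operator `Lₙ g = (σₙ² / 2) g'' + βₙ' g'`. -/
def regOp (σ β : ℝ → ℝ) (Φ : 𝓢(ℝ, ℝ)) (n : ℕ) (g : ℝ → ℝ) (x : ℝ) : ℝ :=
  sigmaSq σ Φ n x / 2 * deriv (deriv g) x + deriv (betaReg β Φ n) x * deriv g x

/-- `f` is a `C¹`-solution of `L f = l`, where formally `L g = (σ² / 2) g'' + β' g'`: for every
mollifier there are `fₙ ∈ C²` and `lₙ ∈ C⁰` with `Lₙ fₙ = lₙ`, `fₙ → f` in `C¹` and `lₙ → l` in `C⁰`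
(for the topologies of uniform convergence on compacts). -/
def IsC1Solution (σ β f l : ℝ → ℝ) : Prop :=
  ContDiff ℝ 1 f ∧ Continuous l ∧
    ∀ Φ : 𝓢(ℝ, ℝ), IsMollifier σ β Φ →
      ∃ fn ln : ℕ → ℝ → ℝ,
        (∀ n, ContDiff ℝ 2 (fn n)) ∧ (∀ n, Continuous (ln n)) ∧
        (∀ n x, regOp σ β Φ n (fn n) x = ln n x) ∧
        TendstoLocallyUniformly fn f atTop ∧
        TendstoLocallyUniformly (fun n => deriv (fn n)) (deriv f) atTop ∧
        TendstoLocallyUniformly ln l atTop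

/-- `S = Σ`: the limit in `C⁰` of `x ↦ 2 ∫₀ˣ βₙ' / σₙ²`, the same for every mollifier. -/
def IsSigma (σ β S : ℝ → ℝ) : Prop :=
  Continuous S ∧
    ∀ Φ : 𝓢(ℝ, ℝ), IsMollifier σ β Φ →
      TendstoLocallyUniformly
        (fun (n : ℕ) (x : ℝ) => 2 * ∫ y in (0 : ℝ)..x, deriv (betaReg β Φ n) y / sigmaSq σ Φ n y)
        S atTop

/-- `u : [a, b] → ℝ` solves the boundary value problem `L u = g`, `u(a) = A`, `u(b) = B`:
it is the restriction of a `C¹`-solution on the line whose right-hand side is a continuous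
extension of `g`. -/
def IsBVPSolution (σ β : ℝ → ℝ) (a b : ℝ) (g : Set.Icc a b → ℝ) (A B : ℝ)
    (u : Set.Icc a b → ℝ) : Prop :=
  ∃ u' g' : ℝ → ℝ, Continuous g' ∧ (∀ x : Set.Icc a b, g' x = g x) ∧
    (∀ x : Set.Icc a b, u' x = u x) ∧ IsC1Solution σ β u' g' ∧ u' a = A ∧ u' b = B

/-- The continuous process `X`, adapted to the filtration `𝓕`, solves the martingale problem for
`L` started at `x₀`: `X₀ = x₀` a.s. and `f(X_t) - f(x₀) - ∫₀ᵗ L f(X_s) ds` is an `𝓕`-local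
martingale for every `f` in the domain of `L` (`l` stands for `L f`). -/
structure SolvesMartingaleProblem {Ω : Type*} [mΩ : MeasurableSpace Ω] (σ β : ℝ → ℝ) (x₀ : ℝ)
    (P : Measure Ω) (𝓕 : Filtration ℝ≥0 mΩ) (X : ℝ≥0 → Ω → ℝ) : Prop where
  adapted : Adapted 𝓕 X
  continuous_paths : ∀ ω, Continuous fun t => X t ω
  initial : ∀ᵐ ω ∂P, X 0 ω = x₀
  local_martingale : ∀ f l : ℝ → ℝ, IsC1Solution σ β f l →
    Locally (fun M : ℝ≥0 → Ω → ℝ => Martingale M 𝓕 P) 𝓕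
      (fun t ω => f (X t ω) - f x₀ - ∫ s in (0 : ℝ)..t, l (X s.toNNReal ω)) P

/-- The exit time `inf {t ≥ 0 | X_t ∉ [0, 1]}`, equal to `∞` if the set is empty. -/
def exitTime {Ω : Type*} (X : ℝ≥0 → Ω → ℝ) (ω : Ω) : ℝ≥0∞ :=
  ⨅ t ∈ {t : ℝ≥0 | X t ω ∉ Set.Icc (0 : ℝ) 1}, (t : ℝ≥0∞)

end

end DistDrift

namespace DistDrift

/-! The function `exp S` is an integrating factor: formally `L f = l` means `(exp S * f')' = 2 * exp
S * l / σ ^ 2`, where `β'` no longer occurs. For the regularised operators this is calculus, and the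
integrated form survives the limit (`IsC1Solution.exists_exp_mul_deriv_eq`). Hence on `[0, 1]` the
derivatives of two solutions of the boundary value problem differ by a multiple of `exp (-S)`, and
the boundary values force the multiple to be zero. Conversely, every primitive `∫ exp (-S) * h` with
`h` in `C¹` lies in the domain (`isC1Solution_integral`); a cut-off `h` gives a solution `f` for
which `f` and `L f` are bounded on the whole line.

For this `f` the local martingale is bounded on `[0, T]`, so stopping it at `τ ∧ T` gives `E(τ ∧ T)
= f(x) - E f(X_{τ ∧ T})`. Boundedness of `f` yields `E τ < ∞`; as `T → ∞` the last term vanishes,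
because `X_τ` is `0` or `1`. -/

/-! ### Locally uniform convergence. -/

/-- Joint limits in `(n, y)` pass through products, quotients and `exp` without local bounds. -/
theorem tendstoLocallyUniformly_iff_tendsto_prod {F : ℕ → ℝ → ℝ} {f : ℝ → ℝ} (hf : Continuous f) :
    TendstoLocallyUniformly F f atTop ↔
      ∀ x, Tendsto (fun p : ℕ × ℝ => F p.1 p.2) (atTop ×ˢ 𝓝 x) (𝓝 (f x)) := by
  rw [tendstoLocallyUniformly_iff_forall_tendsto]
  refine forall_congr' fun x => ?_
  have h2 : Tendsto (fun p : ℕ × ℝ => f p.2) (atTop ×ˢ 𝓝 x) (𝓝 (f x)) :=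
    (hf.tendsto x).comp tendsto_snd
  rw [tendsto_uniformity_iff_dist_tendsto_zero]
  constructor
  · intro h
    have h3 : Tendsto (fun p : ℕ × ℝ => F p.1 p.2 - f p.2) (atTop ×ˢ 𝓝 x) (𝓝 0) := by
      rw [tendsto_zero_iff_norm_tendsto_zero]
      simpa only [dist_comm, dist_eq_norm] using h
    simpa using h3.add h2
  · intro h
    simpa using h2.dist h

theorem tendstoLocallyUniformly_congr_Icc {F G : ℕ → ℝ → ℝ} {f : ℝ → ℝ} (hf : Continuous f)
    (hFG : ∀ R : ℝ, ∀ᶠ n in atTop, ∀ y ∈ Set.Icc (-R) R, F n y = G n y)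
    (hF : TendstoLocallyUniformly F f atTop) : TendstoLocallyUniformly G f atTop := by
  rw [tendstoLocallyUniformly_iff_tendsto_prod hf] at hF ⊢
  intro x
  refine (hF x).congr' ?_
  have hx : ∀ᶠ y in 𝓝 x, y ∈ Set.Icc (-(|x| + 1)) (|x| + 1) :=
    Icc_mem_nhds (by linarith [neg_abs_le x]) (by linarith [le_abs_self x])
  filter_upwards [(hFG (|x| + 1)).prod_mk hx] with p hp using hp.1 p.2 hp.2

theorem eventually_forall_Icc_of_tendstoLocallyUniformly {F : ℕ → ℝ → ℝ} {f : ℝ → ℝ}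
    (hF : TendstoLocallyUniformly F f atTop) (R : ℝ) {ε : ℝ} (hε : 0 < ε) :
    ∀ᶠ n in atTop, ∀ y ∈ Set.Icc (-R) R, |F n y - f y| < ε := by
  have h := tendstoLocallyUniformly_iff_forall_isCompact.1 hF _ (isCompact_Icc (a := -R) (b := R))
  filter_upwards [Metric.tendstoUniformlyOn_iff.1 h ε hε] with n hn y hy
  rw [abs_sub_comm]
  exact hn y hy

theorem uIoc_zero_subset_Icc {x R : ℝ} (hx : x ∈ Set.Icc (-R) R) :
    Set.uIcc 0 x ⊆ Set.Icc (-R) R := by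
  have : 0 ≤ R := by linarith [hx.1, hx.2]
  exact Set.uIcc_subset_Icc ⟨by linarith, this⟩ hx

theorem tendstoLocallyUniformly_integral {F : ℕ → ℝ → ℝ} {f : ℝ → ℝ} (hf : Continuous f)
    (hFc : ∀ n, Continuous (F n)) (hF : TendstoLocallyUniformly F f atTop) :
    TendstoLocallyUniformly (fun n x => ∫ y in (0 : ℝ)..x, F n y) (fun x => ∫ y in (0 : ℝ)..x, f y)
      atTop := by
  rw [tendstoLocallyUniformly_iff_forall_isCompact]
  intro K hK
  obtain ⟨R, hR⟩ := hK.isBounded.subset_closedBall 0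
  rw [Metric.tendstoUniformlyOn_iff]
  intro ε hε
  set δ : ℝ := ε / (|R| + 1) with hδ
  have hRpos : 0 < |R| + 1 := by positivity
  have hδpos : 0 < δ := by positivity
  filter_upwards [eventually_forall_Icc_of_tendstoLocallyUniformly hF R hδpos] with n hn x hx
  have hxR : x ∈ Set.Icc (-R) R := by simpa [Real.closedBall_eq_Icc] using hR hx
  rw [dist_comm, Real.dist_eq, ← intervalIntegral.integral_sub ((hFc n).intervalIntegrable _ _)
    (hf.intervalIntegrable _ _)]
  have h1 : ‖∫ y in (0 : ℝ)..x, (F n y - f y)‖ ≤ δ * |x - 0| := by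
    refine intervalIntegral.norm_integral_le_of_norm_le_const fun y hy => ?_
    exact (hn y (uIoc_zero_subset_Icc hxR (Set.uIoc_subset_uIcc hy))).le
  have h2 : |x - 0| < |R| + 1 := by
    rw [sub_zero]
    have := abs_le.2 hxR
    linarith [le_abs_self R]
  calc _ ≤ δ * |x - 0| := h1
    _ < δ * (|R| + 1) := by gcongr
    _ = ε := by rw [hδ]; field_simp

/-! ### The integrating factor and the first-order form of the equation. -/

/-- A positive function that agrees with `sigmaSq σ Φ n` on any given compact set
for large `n`. -/
noncomputable def sigmaPos (σ : ℝ → ℝ) (Φ : 𝓢(ℝ, ℝ)) (n : ℕ) (x : ℝ) : ℝ :=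
  max (sigmaSq σ Φ n x) (σ x ^ 2 / 2)

/-- The primitive of `2 βₙ' / σₙ²` with `sigmaPos` as denominator. -/
noncomputable def scaleExp (σ β : ℝ → ℝ) (Φ : 𝓢(ℝ, ℝ)) (n : ℕ) (x : ℝ) : ℝ :=
  ∫ y in (0 : ℝ)..x, 2 * deriv (betaReg β Φ n) y / sigmaPos σ Φ n y

section

variable {σ β S : ℝ → ℝ} {Φ : 𝓢(ℝ, ℝ)}

theorem sigmaPos_pos (hσ_pos : ∀ x, 0 < σ x) (n : ℕ) (x : ℝ) : 0 < sigmaPos σ Φ n x :=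
  lt_max_of_lt_right (by have := hσ_pos x; positivity)

theorem continuous_sigmaPos (hσ : Continuous σ) (hΦ : IsMollifier σ β Φ) (n : ℕ) :
    Continuous (sigmaPos σ Φ n) :=
  (hΦ.sigma_continuous n).max (by fun_prop)

/-- Since `Φ` may change sign, `sigmaSq` can vanish or be negative. On a compact set it is
eventually closer to `σ ^ 2` than half the minimum of `σ ^ 2`, and then the maximum in `sigmaPos`
selects it. -/
theorem eventually_sigmaPos_eq (hσ : Continuous σ) (hσ_pos : ∀ x, 0 < σ x)
    (hΦ : IsMollifier σ β Φ) (R : ℝ) :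
    ∀ᶠ n in atTop, ∀ y ∈ Set.Icc (-R) R, sigmaSq σ Φ n y = sigmaPos σ Φ n y := by
  rcases lt_or_ge R 0 with hR | hR
  · filter_upwards with n y hy
    linarith [hy.1, hy.2]
  obtain ⟨z, -, hz⟩ := (isCompact_Icc (a := -R) (b := R)).exists_isMinOn
    ⟨0, by linarith, hR⟩ (f := fun y => σ y ^ 2 / 2) (by fun_prop)
  have hpos : 0 < σ z ^ 2 / 2 := by have := hσ_pos z; positivity
  filter_upwards [eventually_forall_Icc_of_tendstoLocallyUniformly hΦ.sigma_tendsto R hpos]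
    with n hn y hy
  refine (max_eq_left ?_).symm
  have h1 := (abs_lt.1 (hn y hy)).1
  have h2 : σ z ^ 2 / 2 ≤ σ y ^ 2 / 2 := hz hy
  linarith

theorem sigmaPos_tendsto (hσ : Continuous σ) (hσ_pos : ∀ x, 0 < σ x) (hΦ : IsMollifier σ β Φ) :
    TendstoLocallyUniformly (sigmaPos σ Φ) (fun x => σ x ^ 2) atTop :=
  tendstoLocallyUniformly_congr_Icc (by fun_prop) (eventually_sigmaPos_eq hσ hσ_pos hΦ)
    hΦ.sigma_tendsto

theorem continuous_scaleExp_integrand (hσ : Continuous σ) (hσ_pos : ∀ x, 0 < σ x)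
    (hΦ : IsMollifier σ β Φ) (n : ℕ) :
    Continuous fun y => 2 * deriv (betaReg β Φ n) y / sigmaPos σ Φ n y :=
  (continuous_const.mul ((hΦ.beta_contDiff n).continuous_deriv le_rfl)).div
    (continuous_sigmaPos hσ hΦ n) fun x => (sigmaPos_pos hσ_pos n x).ne'

theorem hasDerivAt_integral_zero {g : ℝ → ℝ} (hg : Continuous g) (x : ℝ) :
    HasDerivAt (fun x => ∫ y in (0 : ℝ)..x, g y) (g x) x :=
  intervalIntegral.integral_hasDerivAt_right (hg.intervalIntegrable _ _)
    hg.aestronglyMeasurable.stronglyMeasurableAtFilter hg.continuousAt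

theorem hasDerivAt_scaleExp (hσ : Continuous σ) (hσ_pos : ∀ x, 0 < σ x)
    (hΦ : IsMollifier σ β Φ) (n : ℕ) (x : ℝ) :
    HasDerivAt (scaleExp σ β Φ n) (2 * deriv (betaReg β Φ n) x / sigmaPos σ Φ n x) x :=
  hasDerivAt_integral_zero (continuous_scaleExp_integrand hσ hσ_pos hΦ n) x

theorem continuous_scaleExp (hσ : Continuous σ) (hσ_pos : ∀ x, 0 < σ x)
    (hΦ : IsMollifier σ β Φ) (n : ℕ) : Continuous (scaleExp σ β Φ n) :=
  continuous_iff_continuousAt.2 fun x => (hasDerivAt_scaleExp hσ hσ_pos hΦ n x).continuousAt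

theorem scaleExp_tendsto (hσ : Continuous σ) (hσ_pos : ∀ x, 0 < σ x) (hS : IsSigma σ β S)
    (hΦ : IsMollifier σ β Φ) : TendstoLocallyUniformly (scaleExp σ β Φ) S atTop := by
  refine tendstoLocallyUniformly_congr_Icc hS.1 (fun R => ?_) (hS.2 Φ hΦ)
  filter_upwards [eventually_sigmaPos_eq hσ hσ_pos hΦ R] with n hn x hx
  rw [← intervalIntegral.integral_const_mul]
  refine intervalIntegral.integral_congr fun y hy => ?_
  rw [hn y (uIoc_zero_subset_Icc hx hy), mul_div_assoc]

/-- Multiplying `Lₙ fₙ = lₙ` by `2 * exp Tₙ / σₙ²`, with `Tₙ = scaleExp σ β Φ n`, turns the left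
side into `(exp Tₙ * fₙ')'`. The integrated identity contains no second derivative, so `C¹`
convergence suffices for the limit. -/
theorem IsC1Solution.exists_exp_mul_deriv_eq (hσ : Continuous σ) (hσ_pos : ∀ x, 0 < σ x)
    (hS : IsSigma σ β S) (hΦ : IsMollifier σ β Φ) {f l : ℝ → ℝ} (hf : IsC1Solution σ β f l) :
    ∃ c, ∀ x, Real.exp (S x) * deriv f x
      = c + ∫ y in (0 : ℝ)..x, 2 * Real.exp (S y) * l y / σ y ^ 2 := by
  obtain ⟨hf1, hl, hfl⟩ := hf
  obtain ⟨fn, ln, hfn, hln, hop, -, hf', hl'⟩ := hfl Φ hΦ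
  have hTc := continuous_scaleExp (β := β) hσ hσ_pos hΦ
  have hf'c := hf1.continuous_deriv le_rfl
  have hT := (tendstoLocallyUniformly_iff_tendsto_prod hS.1).1 (scaleExp_tendsto hσ hσ_pos hS hΦ)
  have hf'' := (tendstoLocallyUniformly_iff_tendsto_prod hf'c).1 hf'
  have hl'' := (tendstoLocallyUniformly_iff_tendsto_prod hl).1 hl'
  have hs := (tendstoLocallyUniformly_iff_tendsto_prod (by fun_prop)).1
    (sigmaPos_tendsto hσ hσ_pos hΦ)
  have hgc : Continuous fun y => 2 * Real.exp (S y) * l y / σ y ^ 2 :=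
    ((continuous_const.mul (Real.continuous_exp.comp hS.1)).mul hl).div (by fun_prop)
      fun x => (pow_pos (hσ_pos x) 2).ne'
  have hint := tendstoLocallyUniformly_integral (f := fun y => 2 * Real.exp (S y) * l y / σ y ^ 2)
    (F := fun n y => 2 * Real.exp (scaleExp σ β Φ n y) * ln n y / sigmaPos σ Φ n y)
    hgc
    (fun n => ((continuous_const.mul (Real.continuous_exp.comp (hTc n))).mul (hln n)).div
      (continuous_sigmaPos hσ hΦ n) fun x => (sigmaPos_pos hσ_pos n x).ne')
    ((tendstoLocallyUniformly_iff_tendsto_prod hgc).2 fun x =>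
      (((Real.continuous_exp.tendsto _).comp (hT x)).const_mul 2 |>.mul (hl'' x)).div (hs x)
        (pow_pos (hσ_pos x) 2).ne')
  have hprodlim : ∀ x, Tendsto (fun n => Real.exp (scaleExp σ β Φ n x) * deriv (fn n) x) atTop
      (𝓝 (Real.exp (S x) * deriv f x)) := fun x =>
    ((Real.continuous_exp.tendsto _).comp
      ((hT x).comp (tendsto_id.prodMk tendsto_const_nhds))).mul
      ((hf'' x).comp (tendsto_id.prodMk tendsto_const_nhds))
  have key : ∀ x, ∀ᶠ n in atTop, Real.exp (scaleExp σ β Φ n x) * deriv (fn n) x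
      = Real.exp (scaleExp σ β Φ n 0) * deriv (fn n) 0
        + ∫ y in (0 : ℝ)..x, 2 * Real.exp (scaleExp σ β Φ n y) * ln n y / sigmaPos σ Φ n y := by
    intro x
    -- The equation involves `sigmaSq` and the integrating factor `sigmaPos`; they agree between `0`
    -- and `x` only for large `n`.
    filter_upwards [eventually_sigmaPos_eq hσ hσ_pos hΦ |x|] with n hn
    have h1 : ContDiff ℝ 1 (deriv (fn n)) :=
      (contDiff_succ_iff_deriv.1 (show ContDiff ℝ (1 + 1) (fn n) by
        simpa [one_add_one_eq_two] using hfn n)).2.2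
    have hd : ∀ y ∈ Set.uIcc 0 x, HasDerivAt
        (fun y => Real.exp (scaleExp σ β Φ n y) * deriv (fn n) y)
        (2 * Real.exp (scaleExp σ β Φ n y) * ln n y / sigmaPos σ Φ n y) y := by
      intro y hy
      have hyI : y ∈ Set.Icc (-|x|) |x| :=
        uIoc_zero_subset_Icc (Set.mem_Icc.2 (abs_le.1 le_rfl)) hy
      have h2 := (hasDerivAt_scaleExp (β := β) hσ hσ_pos hΦ n y).exp.mul
        ((h1.differentiable one_ne_zero) y).hasDerivAt
      refine h2.congr_deriv ?_
      rw [← hop n y, regOp, hn y hyI]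
      have := (sigmaPos_pos (Φ := Φ) hσ_pos n y).ne'
      field_simp
      ring
    have := intervalIntegral.integral_eq_sub_of_hasDerivAt hd (Continuous.intervalIntegrable
      (((continuous_const.mul (Real.continuous_exp.comp (hTc n))).mul (hln n)).div
      (continuous_sigmaPos hσ hΦ n) fun x => (sigmaPos_pos hσ_pos n x).ne') _ _)
    linarith
  refine ⟨Real.exp (S 0) * deriv f 0, fun x => ?_⟩
  have hi : Tendsto (fun n => ∫ y in (0 : ℝ)..x,
      2 * Real.exp (scaleExp σ β Φ n y) * ln n y / sigmaPos σ Φ n y) atTop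
      (𝓝 (∫ y in (0 : ℝ)..x, 2 * Real.exp (S y) * l y / σ y ^ 2)) :=
    hint.tendstoLocallyUniformlyOn (s := Set.univ) |>.tendsto_at (Set.mem_univ x)
  exact tendsto_nhds_unique_of_eventuallyEq (hprodlim x) ((hprodlim 0).add hi) (key x)

end

/-! ### Construction of functions in the domain of `L`. -/

section

variable {σ β S : ℝ → ℝ} {Φ : 𝓢(ℝ, ℝ)}

theorem continuous_regOp (hΦ : IsMollifier σ β Φ) (n : ℕ) {g : ℝ → ℝ} (hg : ContDiff ℝ 2 g) :
    Continuous (regOp σ β Φ n g) := by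
  have h1 : ContDiff ℝ 1 (deriv g) :=
    (contDiff_succ_iff_deriv.1 (show ContDiff ℝ (1 + 1) g by
      simpa [one_add_one_eq_two] using hg)).2.2
  exact (((hΦ.sigma_continuous n).div_const 2).mul (h1.continuous_deriv le_rfl)).add
    (((hΦ.beta_contDiff n).continuous_deriv le_rfl).mul h1.continuous)

theorem contDiff_one_of_hasDerivAt {f f' : ℝ → ℝ} (h : ∀ x, HasDerivAt f (f' x) x)
    (hf' : Continuous f') : ContDiff ℝ 1 f := by
  rw [contDiff_one_iff_deriv]
  refine ⟨fun x => (h x).differentiableAt, ?_⟩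
  rwa [funext fun x => (h x).deriv]

theorem contDiff_two_of_hasDerivAt {f f' : ℝ → ℝ} (h : ∀ x, HasDerivAt f (f' x) x)
    (hf' : ContDiff ℝ 1 f') : ContDiff ℝ 2 f := by
  have : ContDiff ℝ (1 + 1) f := by
    rw [contDiff_succ_iff_deriv]
    refine ⟨fun x => (h x).differentiableAt, by simp, ?_⟩
    rwa [funext fun x => (h x).deriv]
  simpa [one_add_one_eq_two] using this

/-- Every function with derivative `exp (-S) h`, `h ∈ C¹`, is in the domain of `L`. -/
theorem isC1Solution_integral (hσ : Continuous σ) (hσ_pos : ∀ x, 0 < σ x)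
    (hS : IsSigma σ β S) {h : ℝ → ℝ} (hh : ContDiff ℝ 1 h) :
    IsC1Solution σ β (fun x => ∫ y in (0 : ℝ)..x, Real.exp (-S y) * h y)
      (fun x => deriv h x * σ x ^ 2 * Real.exp (-S x) / 2) := by
  have hh' := hh.continuous_deriv le_rfl
  have hSc := hS.1
  have hf : ∀ x, HasDerivAt (fun x => ∫ y in (0 : ℝ)..x, Real.exp (-S y) * h y)
      (Real.exp (-S x) * h x) x := hasDerivAt_integral_zero (by fun_prop)
  refine ⟨contDiff_one_of_hasDerivAt hf (by fun_prop), by fun_prop, fun Φ hΦ => ?_⟩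
  set T := scaleExp σ β Φ
  have hTc : ∀ n, Continuous (T n) := continuous_scaleExp hσ hσ_pos hΦ
  have hTd : ∀ n x, HasDerivAt (T n) _ x := hasDerivAt_scaleExp hσ hσ_pos hΦ
  have hsc := continuous_sigmaPos hσ hΦ
  have hspos : ∀ n x, sigmaPos σ Φ n x ≠ 0 := fun n x => (sigmaPos_pos hσ_pos n x).ne'
  have hT := (tendstoLocallyUniformly_iff_tendsto_prod hS.1).1 (scaleExp_tendsto hσ hσ_pos hS hΦ)
  have hs := (tendstoLocallyUniformly_iff_tendsto_prod (by fun_prop)).1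
    (sigmaPos_tendsto hσ hσ_pos hΦ)
  -- As `S` is merely continuous, `exp (-S) * h` is replaced by `exp (-Tₙ) * kₙ` with `kₙ' = qₙ`.
  -- The regularised operator with `sigmaPos` maps its primitive to `sigmaPos * exp (-Tₙ) * qₙ / 2`;
  -- `qₙ` is chosen to make this exactly `l`.
  set q : ℕ → ℝ → ℝ := fun n y =>
    deriv h y * Real.exp (T n y - S y) * (σ y ^ 2 / sigmaPos σ Φ n y) with hq
  have hqc : ∀ n, Continuous (q n) := fun n =>
    (hh'.mul (Real.continuous_exp.comp ((hTc n).sub hSc))).mul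
      ((hσ.pow 2).div (hsc n) (hspos n))
  have hqlim : TendstoLocallyUniformly q (deriv h) atTop := by
    rw [tendstoLocallyUniformly_iff_tendsto_prod hh']
    intro x
    have h1 := (Real.continuous_exp.tendsto _).comp
      ((hT x).sub ((hSc.tendsto x).comp tendsto_snd))
    have h2 := ((((hσ.pow 2).tendsto x).comp tendsto_snd).div (hs x)
        (pow_pos (hσ_pos x) 2).ne')
    have h3 := (((hh'.tendsto x).comp tendsto_snd).mul h1).mul h2
    have h4 : σ x ^ 2 ≠ 0 := (pow_pos (hσ_pos x) 2).ne'
    simpa [h4] using h3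
  set k : ℕ → ℝ → ℝ := fun n x => h 0 + ∫ y in (0 : ℝ)..x, q n y with hk
  have hkd : ∀ n x, HasDerivAt (k n) (q n x) x := fun n x =>
    (hasDerivAt_integral_zero (hqc n) x).const_add _
  have hkc : ∀ n, Continuous (k n) := fun n =>
    continuous_iff_continuousAt.2 fun x => (hkd n x).continuousAt
  have hheq : ∀ x, h 0 + ∫ y in (0 : ℝ)..x, deriv h y = h x := fun x => by
    rw [intervalIntegral.integral_deriv_eq_sub' h rfl
      (fun y _ => (hh.differentiable one_ne_zero) y) hh'.continuousOn]
    ring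
  have hklim : ∀ x, Tendsto (fun p : ℕ × ℝ => k p.1 p.2) (atTop ×ˢ 𝓝 x) (𝓝 (h x)) := fun x => by
    have h1 := (tendstoLocallyUniformly_iff_tendsto_prod
      (continuous_iff_continuousAt.2 fun x => (hasDerivAt_integral_zero hh' x).continuousAt)).1
      (tendstoLocallyUniformly_integral hh' hqc hqlim) x
    rw [← hheq x]
    exact h1.const_add _
  set g : ℕ → ℝ → ℝ := fun n x => Real.exp (-T n x) * k n x with hg
  have hgc : ∀ n, Continuous (g n) := fun n => (Real.continuous_exp.comp (hTc n).neg).mul (hkc n)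
  have hglim : TendstoLocallyUniformly g (fun x => Real.exp (-S x) * h x) atTop := by
    rw [tendstoLocallyUniformly_iff_tendsto_prod (by fun_prop)]
    exact fun x => ((Real.continuous_exp.tendsto _).comp (hT x).neg).mul (hklim x)
  have hgd : ∀ n x, HasDerivAt (g n)
      (Real.exp (-T n x) * -(2 * deriv (betaReg β Φ n) x / sigmaPos σ Φ n x) * k n x
        + Real.exp (-T n x) * q n x) x := fun n x => ((hTd n x).neg.exp).mul (hkd n x)
  have hg1 : ∀ n, ContDiff ℝ 1 (g n) := fun n =>
    contDiff_one_of_hasDerivAt (hgd n)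
      ((((Real.continuous_exp.comp (hTc n).neg).mul
        (continuous_scaleExp_integrand hσ hσ_pos hΦ n).neg).mul (hkc n)).add
        ((Real.continuous_exp.comp (hTc n).neg).mul (hqc n)))
  have hFd : ∀ n x, HasDerivAt (fun x => ∫ y in (0 : ℝ)..x, g n y) (g n x) x := fun n =>
    hasDerivAt_integral_zero (hgc n)
  have hF2 : ∀ n, ContDiff ℝ 2 (fun x => ∫ y in (0 : ℝ)..x, g n y) := fun n =>
    contDiff_two_of_hasDerivAt (hFd n) (hg1 n)
  have hF' : ∀ n, deriv (fun x => ∫ y in (0 : ℝ)..x, g n y) = g n := fun n =>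
    funext fun x => (hFd n x).deriv
  refine ⟨fun n x => ∫ y in (0 : ℝ)..x, g n y,
    fun n => regOp σ β Φ n (fun x => ∫ y in (0 : ℝ)..x, g n y), hF2,
    fun n => continuous_regOp hΦ n (hF2 n), fun _ _ => rfl,
    tendstoLocallyUniformly_integral (by fun_prop) hgc hglim, ?_, ?_⟩
  · rw [funext fun x => (hf x).deriv]
    simpa only [hF'] using hglim
  · have hlc : Continuous fun x => deriv h x * σ x ^ 2 * Real.exp (-S x) / 2 := by fun_prop
    -- On each compact set `lₙ = l` for large `n`, so the comparison is with a constant sequence.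
    refine tendstoLocallyUniformly_congr_Icc hlc (fun R => ?_)
      ((tendstoLocallyUniformly_iff_tendsto_prod hlc
        (F := fun _ x => deriv h x * σ x ^ 2 * Real.exp (-S x) / 2)).2
        fun x => (hlc.tendsto x).comp tendsto_snd)
    filter_upwards [eventually_sigmaPos_eq hσ hσ_pos hΦ R] with n hn x hx
    have hne := hspos n x
    rw [regOp, hF', (hgd n x).deriv, hn x hx]
    simp only [hg, hq, sub_eq_add_neg, Real.exp_add]
    have hE : Real.exp (T n x) * Real.exp (-T n x) = 1 := by rw [← Real.exp_add]; simp
    field_simp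
    linear_combination (-(deriv h x * σ x ^ 2 * Real.exp (-S x))) * hE

/-! ### Existence of a mollifier. -/

theorem continuous_rescale (Φ : 𝓢(ℝ, ℝ)) (n : ℕ) : Continuous (rescale Φ n) := by
  have := Φ.continuous
  unfold rescale
  fun_prop

theorem contDiff_rescale (Φ : 𝓢(ℝ, ℝ)) (n : ℕ) : ContDiff ℝ 1 (rescale Φ n) := by
  have := Φ.smooth 1
  unfold rescale
  fun_prop

theorem integral_rescale (hΦ : ∫ x, Φ x = 1) {n : ℕ} (hn : n ≠ 0) : ∫ x, rescale Φ n x = 1 := by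
  have hn' : (n : ℝ) ≠ 0 := by exact_mod_cast hn
  have h0 : (0 : ℝ) ≤ (n : ℝ)⁻¹ := by positivity
  simp only [rescale]
  rw [integral_const_mul, Measure.integral_comp_mul_left (fun x => Φ x) (n : ℝ), hΦ,
    abs_of_nonneg h0]
  simp [hn']

theorem hasCompactSupport_rescale (hΦ : HasCompactSupport Φ) (n : ℕ) :
    HasCompactSupport (rescale Φ n) := by
  rcases eq_or_ne n 0 with rfl | hn
  · have : rescale Φ 0 = 0 := by ext x; simp [rescale]
    rw [this]
    exact HasCompactSupport.zero
  · have hn' : (n : ℝ) ≠ 0 := by exact_mod_cast hn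
    have := (hΦ.comp_homeomorph (Homeomorph.mulLeft₀ (n : ℝ) hn'))
    exact HasCompactSupport.mul_left (f := fun _ => (n : ℝ)) this

theorem convolution_rescale_tendsto {g : ℝ → ℝ} (hg : Continuous g) (hpos : ∀ x, 0 ≤ Φ x)
    (hcs : HasCompactSupport Φ) (hΦ : ∫ x, Φ x = 1) :
    TendstoLocallyUniformly (fun n => g ⋆ rescale Φ n) g atTop := by
  rw [tendstoLocallyUniformly_iff_tendsto_prod hg]
  intro x
  have hcomm : ∀ n, g ⋆ rescale Φ n = rescale Φ n ⋆ g := fun n => by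
    rw [← convolution_flip]
    congr 1
    ext
    simp
  simp only [hcomm]
  refine convolution_tendsto_right (φ := fun p : ℕ × ℝ => rescale Φ p.1)
    (g := fun _ => g) (k := fun p : ℕ × ℝ => p.2) ?_ ?_ ?_ ?_ ?_ tendsto_snd
  · exact Eventually.of_forall fun p y => mul_nonneg (Nat.cast_nonneg _) (hpos _)
  · filter_upwards [tendsto_fst.eventually (eventually_ne_atTop 0)] with p hp
    exact integral_rescale hΦ hp
  · refine Tendsto.comp (g := fun n => Function.support (rescale Φ n)) ?_ tendsto_fst
    rw [tendsto_smallSets_iff]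
    intro U hU
    obtain ⟨ε, hε, hU⟩ := Metric.mem_nhds_iff.1 hU
    obtain ⟨R, hR⟩ := hcs.isCompact.isBounded.subset_closedBall 0
    filter_upwards [(tendsto_natCast_atTop_atTop (R := ℝ)).eventually_gt_atTop (|R| / ε),
      eventually_gt_atTop 0] with n hn hn0 y hy
    apply hU
    have hy' : Φ (n * y) ≠ 0 := right_ne_zero_of_mul hy
    have h1 : n * y ∈ Metric.closedBall (0 : ℝ) R := hR (subset_tsupport _ hy')
    have hn0' : (0 : ℝ) < n := by exact_mod_cast hn0
    rw [mem_closedBall_zero_iff, Real.norm_eq_abs, abs_mul, abs_of_pos hn0'] at h1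
    rw [mem_ball_zero_iff, Real.norm_eq_abs]
    rw [div_lt_iff₀ hε] at hn
    have : n * |y| < n * ε := by linarith [le_abs_self R]
    exact lt_of_mul_lt_mul_left this hn0'.le
  · exact Eventually.of_forall fun _ => hg.aestronglyMeasurable
  · exact (hg.tendsto x).comp tendsto_snd

/-- Without a mollifier, `IsC1Solution` would impose no equation and uniqueness would fail. A
normalised smooth bump qualifies whatever the growth of `σ` and `β`. -/
theorem exists_isMollifier (hσ : Continuous σ) (hβ : Continuous β) :
    ∃ Φ : 𝓢(ℝ, ℝ), IsMollifier σ β Φ := by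
  let b : ContDiffBump (0 : ℝ) := ⟨1, 2, one_pos, one_lt_two⟩
  let Φ : 𝓢(ℝ, ℝ) := (b.hasCompactSupport_normed (μ := volume)).toSchwartzMap b.contDiff_normed
  have hcs : HasCompactSupport Φ := b.hasCompactSupport_normed (μ := volume)
  have hpos : ∀ x, 0 ≤ Φ x := b.nonneg_normed (μ := volume)
  have hint : ∫ x, Φ x = 1 := b.integral_normed (μ := volume)
  have hσ2 : Continuous fun x => σ x ^ 2 := by fun_prop
  refine ⟨Φ, hint, fun n => ?_, fun n => ?_, fun n => ?_, fun n => ?_, ?_, ?_⟩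
  · exact (hasCompactSupport_rescale hcs n).convolutionExists_right _
      hσ2.locallyIntegrable (continuous_rescale Φ n)
  · exact (hasCompactSupport_rescale hcs n).convolutionExists_right _
      hβ.locallyIntegrable (continuous_rescale Φ n)
  · exact (hasCompactSupport_rescale hcs n).continuous_convolution_right _
      hσ2.locallyIntegrable (continuous_rescale Φ n)
  · exact (hasCompactSupport_rescale hcs n).contDiff_convolution_right _
      hβ.locallyIntegrable (contDiff_rescale Φ n)
  · exact convolution_rescale_tendsto hσ2 hpos hcs hint
  · exact convolution_rescale_tendsto hβ hpos hcs hint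

/-! ### The boundary value problem. -/

/-- Two solutions of `L u = -1` on `[0, 1]` with zero boundary values agree on `[0, 1]`. -/
theorem IsC1Solution.eqOn_of_boundary (hσ : Continuous σ) (hσ_pos : ∀ x, 0 < σ x)
    (hβ : Continuous β) (hS : IsSigma σ β S) {u v g k : ℝ → ℝ} (hu : IsC1Solution σ β u g)
    (hv : IsC1Solution σ β v k) (hgk : ∀ x ∈ Set.Icc (0 : ℝ) 1, g x = k x)
    (h0 : u 0 = v 0) (h1 : u 1 = v 1) : Set.EqOn u v (Set.Icc 0 1) := by
  obtain ⟨Φ, hΦ⟩ := exists_isMollifier hσ hβ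
  obtain ⟨c, hc⟩ := hu.exists_exp_mul_deriv_eq hσ hσ_pos hS hΦ
  obtain ⟨d, hd⟩ := hv.exists_exp_mul_deriv_eq hσ hσ_pos hS hΦ
  have hSc := hS.1
  -- For `x` in `[0, 1]` the integrals from `0` to `x` see the right-hand sides only where they
  -- agree.
  have hderiv : ∀ x ∈ Set.Icc (0 : ℝ) 1,
      deriv u x - deriv v x = (c - d) * Real.exp (-S x) := by
    intro x hx
    have hi : ∫ y in (0 : ℝ)..x, 2 * Real.exp (S y) * g y / σ y ^ 2
        = ∫ y in (0 : ℝ)..x, 2 * Real.exp (S y) * k y / σ y ^ 2 := by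
      refine intervalIntegral.integral_congr fun y hy => ?_
      rw [Set.uIcc_of_le hx.1] at hy
      rw [hgk y ⟨hy.1, hy.2.trans hx.2⟩]
    have h2 := hc x
    rw [hi] at h2
    have h3 := hd x
    rw [Real.exp_neg]
    field_simp
    linarith
  have hint : ∀ x ∈ Set.Icc (0 : ℝ) 1,
      u x - v x = (c - d) * ∫ y in (0 : ℝ)..x, Real.exp (-S y) := by
    intro x hx
    have hd' : ∀ y, HasDerivAt (fun y => u y - v y) (deriv u y - deriv v y) y := fun y =>
      ((hu.1.differentiable one_ne_zero) y).hasDerivAt.sub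
        ((hv.1.differentiable one_ne_zero) y).hasDerivAt
    have h2 := intervalIntegral.integral_eq_sub_of_hasDerivAt (a := 0) (b := x)
      (fun y _ => hd' y)
      (((hu.1.continuous_deriv le_rfl).sub (hv.1.continuous_deriv le_rfl)).intervalIntegrable _ _)
    rw [← intervalIntegral.integral_const_mul]
    have h3 : ∫ y in (0 : ℝ)..x, (deriv u y - deriv v y)
        = ∫ y in (0 : ℝ)..x, (c - d) * Real.exp (-S y) := by
      refine intervalIntegral.integral_congr fun y hy => ?_
      rw [Set.uIcc_of_le hx.1] at hy
      exact hderiv y ⟨hy.1, hy.2.trans hx.2⟩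
    linarith
  have hposI : 0 < ∫ y in (0 : ℝ)..1, Real.exp (-S y) :=
    intervalIntegral.intervalIntegral_pos_of_pos
      ((Real.continuous_exp.comp hSc.neg).intervalIntegrable _ _)
      (fun y => Real.exp_pos _) one_pos
  have hcd : c - d = 0 := by
    have := hint 1 ⟨zero_le_one, le_rfl⟩
    rw [h1, sub_self] at this
    exact (mul_eq_zero.1 this.symm).resolve_right hposI.ne'
  intro x hx
  have := hint x hx
  rw [hcd, zero_mul] at this
  linarith

/-- A bounded function in the domain of `L` with bounded image under `L` that solves `L f = -1`
on `[0, 1]` with zero boundary values. -/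
theorem exists_bounded_isC1Solution (hσ : Continuous σ) (hσ_pos : ∀ x, 0 < σ x)
    (hS : IsSigma σ β S) :
    ∃ (f l : ℝ → ℝ) (C : ℝ), IsC1Solution σ β f l ∧ (∀ x ∈ Set.Icc (0 : ℝ) 1, l x = -1) ∧
      f 0 = 0 ∧ f 1 = 0 ∧ (∀ x, |f x| ≤ C) ∧ ∀ x, |l x| ≤ C := by
  have hSc := hS.1
  let p : ℝ → ℝ := fun y => 2 * Real.exp (S y) / σ y ^ 2
  have hpc : Continuous p := Continuous.div (by fun_prop) (by fun_prop)
    fun x => (pow_pos (hσ_pos x) 2).ne'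
  let m : ℝ → ℝ := fun x => ∫ y in (0 : ℝ)..x, p y
  have hmd : ∀ x, HasDerivAt m (p x) x := hasDerivAt_integral_zero hpc
  have hm1 : ContDiff ℝ 1 m := contDiff_one_of_hasDerivAt hmd hpc
  have hmc := hm1.continuous
  have hposI : 0 < ∫ y in (0 : ℝ)..1, Real.exp (-S y) :=
    intervalIntegral.intervalIntegral_pos_of_pos
      ((Real.continuous_exp.comp hSc.neg).intervalIntegrable _ _)
      (fun y => Real.exp_pos _) one_pos
  set I := ∫ y in (0 : ℝ)..1, Real.exp (-S y) with hI
  -- This value makes `∫ exp (-S) * (c - m)` over `[0, 1]` vanish, which is `f 1 = 0`.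
  let c : ℝ := (∫ y in (0 : ℝ)..1, Real.exp (-S y) * m y) / I
  -- The cut-off is `1` on `[-1/2, 3/2]`, a neighbourhood of `[0, 1]`, so `deriv h` is unchanged
  -- even at the endpoints. Its compact support bounds both `f` and `l`.
  let χ : ContDiffBump (1 / 2 : ℝ) := ⟨1, 2, one_pos, one_lt_two⟩
  have hχ1 : ContDiff ℝ 1 χ := χ.contDiff
  let h : ℝ → ℝ := fun x => χ x * (c - m x)
  have hh : ContDiff ℝ 1 h := hχ1.mul (contDiff_const.sub hm1)
  have hhcs : HasCompactSupport h := χ.hasCompactSupport.mul_right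
  have hh' := hh.continuous_deriv le_rfl
  have hhc := hh.continuous
  have hball : ∀ x ∈ Set.Icc (0 : ℝ) 1, x ∈ Metric.ball (1 / 2 : ℝ) 1 := fun x hx => by
    rw [Metric.mem_ball, Real.dist_eq, abs_lt]
    constructor <;> linarith [hx.1, hx.2]
  have hh_eq : ∀ x ∈ Metric.ball (1 / 2 : ℝ) 1, h x = c - m x := fun x hx => by
    simp [h, χ.one_of_mem_closedBall (Metric.ball_subset_closedBall hx)]
  have hh'_eq : ∀ x ∈ Set.Icc (0 : ℝ) 1, deriv h x = -p x := fun x hx => by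
    have h1 : h =ᶠ[𝓝 x] fun x => c - m x := by
      filter_upwards [Metric.isOpen_ball.mem_nhds (hball x hx)] with y hy using hh_eq y hy
    rw [h1.deriv_eq]
    exact ((hmd x).const_sub c).deriv
  have hgc : Continuous fun y => Real.exp (-S y) * h y := by fun_prop
  have hlc : Continuous fun x => deriv h x * σ x ^ 2 * Real.exp (-S x) / 2 := by fun_prop
  have hlcs : HasCompactSupport fun x => deriv h x * σ x ^ 2 * Real.exp (-S x) / 2 := by
    have := (hhcs.deriv.mul_right (f' := fun x => σ x ^ 2)).mul_right
      (f' := fun x => Real.exp (-S x))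
    exact this.mul_right (f' := fun _ => (2 : ℝ)⁻¹)
  have hgint : Integrable fun y => Real.exp (-S y) * h y :=
    hgc.integrable_of_hasCompactSupport hhcs.mul_left
  obtain ⟨C, hC⟩ := hlc.bounded_above_of_compact_support hlcs
  refine ⟨_, _, max C (∫ y, |Real.exp (-S y) * h y|), isC1Solution_integral hσ hσ_pos hS hh,
    fun x hx => ?_, by simp, ?_, fun x => le_max_of_le_right ?_,
    fun x => le_max_of_le_left (hC x)⟩
  · rw [hh'_eq x hx, Real.exp_neg]
    have := (hσ_pos x).ne'
    simp only [p]
    field_simp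
  · have h1 : ∫ y in (0 : ℝ)..1, Real.exp (-S y) * h y
        = ∫ y in (0 : ℝ)..1, (c * Real.exp (-S y) - Real.exp (-S y) * m y) := by
      refine intervalIntegral.integral_congr fun y hy => ?_
      rw [Set.uIcc_of_le zero_le_one] at hy
      rw [hh_eq y (hball y hy)]
      ring
    rw [h1, intervalIntegral.integral_sub (Continuous.intervalIntegrable (by fun_prop) _ _)
      (Continuous.intervalIntegrable (by fun_prop) _ _), intervalIntegral.integral_const_mul, ← hI]
    simp only [c]
    field_simp
    ring
  · rw [← Real.norm_eq_abs]
    refine intervalIntegral.norm_integral_le_integral_norm_uIoc.trans ?_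
    exact setIntegral_le_integral hgint.norm (Eventually.of_forall fun y => norm_nonneg _)

theorem existsUnique_isBVPSolution (hσ : Continuous σ) (hσ_pos : ∀ x, 0 < σ x)
    (hβ : Continuous β) (hS : IsSigma σ β S) :
    ∃! Γ : Set.Icc (0 : ℝ) 1 → ℝ, IsBVPSolution σ β 0 1 (fun _ => -1) 0 0 Γ := by
  obtain ⟨f, l, -, hf, hl, hf0, hf1, -, -⟩ := exists_bounded_isC1Solution hσ hσ_pos hS
  refine ⟨fun x => f x, ⟨f, l, hf.2.1, fun x => hl x x.2, fun _ => rfl, hf, hf0, hf1⟩, ?_⟩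
  rintro Γ ⟨u, g, -, hg, hu, hug, hu0, hu1⟩
  ext x
  rw [← hu x]
  exact hug.eqOn_of_boundary hσ hσ_pos hβ hS hf (fun y hy => (hg ⟨y, hy⟩).trans (hl y hy).symm)
    (hu0.trans hf0.symm) (hu1.trans hf1.symm) x.2

end

/-! ### The exit time. -/

section

variable {Ω : Type*} {X : ℝ≥0 → Ω → ℝ}

theorem exitTime_lt_iff {ω : Ω} {a : ℝ≥0∞} :
    exitTime X ω < a ↔ ∃ s : ℝ≥0, X s ω ∉ Set.Icc (0 : ℝ) 1 ∧ (s : ℝ≥0∞) < a := by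
  simp only [exitTime, iInf_lt_iff, Set.mem_ofPred_eq, exists_prop]

/-- The times before `a` spent outside the closed interval form an open set, which meets `D` if
nonempty. For countable `D` this gives measurability. -/
theorem exitTime_lt_eq_biUnion (hX : ∀ ω, Continuous fun t => X t ω) {D : Set ℝ≥0}
    (hD : Dense D) (a : ℝ≥0∞) :
    {ω | exitTime X ω < a}
      = ⋃ s ∈ D ∩ {s | (s : ℝ≥0∞) < a}, X s ⁻¹' (Set.Icc (0 : ℝ) 1)ᶜ := by
  ext ω
  simp only [Set.mem_ofPred_eq, exitTime_lt_iff, Set.mem_iUnion, Set.mem_preimage,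
    Set.mem_compl_iff, exists_prop, Set.mem_inter_iff]
  constructor
  · rintro ⟨s, hs, hsa⟩
    have hopen : IsOpen ({s : ℝ≥0 | X s ω ∉ Set.Icc (0 : ℝ) 1} ∩ {s | (s : ℝ≥0∞) < a}) :=
      (isClosed_Icc.isOpen_compl.preimage (hX ω)).inter
        (isOpen_Iio.preimage ENNReal.continuous_coe)
    obtain ⟨r, ⟨hr1, hr2⟩, hrD⟩ := hD.inter_open_nonempty _ hopen ⟨s, hs, hsa⟩
    exact ⟨r, ⟨hrD, hr2⟩, hr1⟩
  · rintro ⟨s, ⟨-, hsa⟩, hs⟩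
    exact ⟨s, hs, hsa⟩

theorem mem_Icc_of_le_exitTime {ω : Ω} (hX : Continuous fun t => X t ω)
    (h0 : X 0 ω ∈ Set.Icc (0 : ℝ) 1) {s : ℝ≥0} (hs : (s : ℝ≥0∞) ≤ exitTime X ω) :
    X s ω ∈ Set.Icc (0 : ℝ) 1 := by
  by_contra hXs
  have hs0 : 0 < s := pos_iff_ne_zero.2 fun h => hXs (h ▸ h0)
  have hnhds : {u | X u ω ∉ Set.Icc (0 : ℝ) 1} ∈ 𝓝 s :=
    (isClosed_Icc.isOpen_compl.preimage hX).mem_nhds hXs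
  obtain ⟨l, hl, hls⟩ := exists_Ioc_subset_of_mem_nhds hnhds ⟨0, hs0⟩
  obtain ⟨u, hlu, hus⟩ := exists_between hl
  have h1 : exitTime X ω < s :=
    exitTime_lt_iff.2 ⟨u, hls ⟨hlu, hus.le⟩, by exact_mod_cast hus⟩
  exact absurd hs h1.not_ge

/-- From an interior position the path would remain inside for a while, and the exit time would be
later. -/
theorem eq_zero_or_one_at_exitTime {ω : Ω} (hX : Continuous fun t => X t ω)
    (h0 : X 0 ω ∈ Set.Icc (0 : ℝ) 1) {s : ℝ≥0} (hs : exitTime X ω = s) :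
    X s ω = 0 ∨ X s ω = 1 := by
  have hmem := mem_Icc_of_le_exitTime hX h0 hs.ge
  by_contra! hne
  have hIoo : X s ω ∈ Set.Ioo (0 : ℝ) 1 :=
    ⟨lt_of_le_of_ne hmem.1 hne.1.symm, lt_of_le_of_ne hmem.2 hne.2⟩
  have hnhds : {u | X u ω ∈ Set.Ioo (0 : ℝ) 1} ∈ 𝓝 s := (isOpen_Ioo.preimage hX).mem_nhds hIoo
  obtain ⟨u, hu, hsu⟩ := exists_Ico_subset_of_mem_nhds hnhds ⟨s + 1, by simp⟩
  obtain ⟨r, hr, hru⟩ := exitTime_lt_iff.1 (show exitTime X ω < u by rw [hs]; exact_mod_cast hu)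
  have hsr : s ≤ r := by
    by_contra! h
    exact hr (mem_Icc_of_le_exitTime hX h0 (by rw [hs]; exact_mod_cast h.le))
  exact hr (Set.Ioo_subset_Icc_self (hsu ⟨hsr, by exact_mod_cast hru⟩))

variable [mΩ : MeasurableSpace Ω] {P : Measure Ω} {𝓕 : Filtration ℝ≥0 mΩ} {M : ℝ≥0 → Ω → ℝ}

theorem measurableSet_exitTime_lt (hXa : Adapted 𝓕 X) (hX : ∀ ω, Continuous fun t => X t ω)
    (t : ℝ≥0) : MeasurableSet[𝓕 t] {ω | exitTime X ω < t} := by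
  obtain ⟨D, hDc, hD⟩ := TopologicalSpace.exists_countable_dense ℝ≥0
  rw [exitTime_lt_eq_biUnion hX hD]
  refine MeasurableSet.biUnion (hDc.mono Set.inter_subset_left) fun s hs => ?_
  have hst : s ≤ t := by exact_mod_cast (show (s : ℝ≥0∞) < t from hs.2).le
  exact 𝓕.mono hst _ (hXa s measurableSet_Icc.compl)

theorem measurable_exitTime (hXa : Adapted 𝓕 X) (hX : ∀ ω, Continuous fun t => X t ω) :
    Measurable (exitTime X) := by
  obtain ⟨D, hDc, hD⟩ := TopologicalSpace.exists_countable_dense ℝ≥0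
  refine measurable_of_Iio fun a => ?_
  change MeasurableSet {ω | exitTime X ω < a}
  rw [exitTime_lt_eq_biUnion hX hD]
  exact MeasurableSet.biUnion (hDc.mono Set.inter_subset_left) fun s _ =>
    𝓕.le s _ (hXa s measurableSet_Icc.compl)

/-! ### Optional stopping. -/

/-- A local martingale that is bounded on bounded time intervals has the martingale property. -/
theorem setIntegral_eq_of_locally_martingale [IsProbabilityMeasure P]
    (hM : Locally (fun M : ℝ≥0 → Ω → ℝ => Martingale M 𝓕 P) 𝓕 M P) {T : ℝ≥0} {C : ℝ}
    (hC : ∀ t ≤ T, ∀ ω, |M t ω| ≤ C) :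
    (∀ t ≤ T, AEStronglyMeasurable (M t) P) ∧
      ∀ s t, s ≤ t → t ≤ T → ∀ A, MeasurableSet[𝓕 s] A →
        ∫ ω in A, M t ω ∂P = ∫ ω in A, M s ω ∂P := by
  obtain ⟨ρ, hρ, hmart⟩ := hM
  set Z : ℕ → ℝ≥0 → Ω → ℝ := fun n =>
    stoppedProcess (fun i => {ω | ⊥ < ρ n ω}.indicator (M i)) (ρ n) with hZ
  have hlim : ∀ t, ∀ᵐ ω ∂P, Tendsto (fun n => Z n t ω) atTop (𝓝 (M t ω)) := by
    intro t
    filter_upwards [hρ.tendsto_top] with ω hω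
    refine tendsto_const_nhds.congr' ?_
    filter_upwards [hω.eventually (lt_mem_nhds (WithTop.coe_lt_top t))] with n hn
    have h1 : ⊥ < ρ n ω := lt_of_le_of_lt bot_le hn
    simp only [hZ, stoppedProcess]
    rw [min_eq_left hn.le, WithTop.untopA, WithTop.untopD_coe, Set.indicator_of_mem]
    exact h1
  have hbound : ∀ n, ∀ t ≤ T, ∀ ω, ‖Z n t ω‖ ≤ C := by
    intro n t ht ω
    simp only [hZ, stoppedProcess]
    refine (norm_indicator_le_norm_self _ _).trans (hC _ ?_ ω)
    refine le_trans ?_ ht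
    exact (WithTop.untopA_mono (WithTop.coe_ne_top) (min_le_left (t : WithTop ℝ≥0) (ρ n ω))).trans
      (WithTop.untopD_coe _ t).le
  have hmeas : ∀ n t, AEStronglyMeasurable (Z n t) P := fun n t =>
    ((hmart n).integrable t).aestronglyMeasurable
  refine ⟨fun t _ => aestronglyMeasurable_of_tendsto_ae atTop (fun n => hmeas n t) (hlim t),
    fun s t hst ht A hA => ?_⟩
  -- The localised processes inherit the bound `C` up to time `T`, so dominated convergence applies.
  have hint : ∀ t ≤ T, Tendsto (fun n => ∫ ω in A, Z n t ω ∂P) atTop (𝓝 (∫ ω in A, M t ω ∂P)) :=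
    fun t ht => tendsto_integral_of_dominated_convergence (fun _ => C)
      (fun n => (hmeas n t).restrict) (integrable_const C)
      (fun n => Eventually.of_forall (hbound n t ht)) (ae_restrict_of_ae (hlim t))
  refine tendsto_nhds_unique (hint t ht) ((hint s (hst.trans ht)).congr fun n => ?_)
  exact (hmart n).setIntegral_eq hst hA

/-- The sum telescopes up to the first grid point beyond `θ`, or to `j * h` if that comes earlier.
The increment after `k * h` is kept on `{k * h ≤ θ}`, an event known at time `k * h` when `θ` is the
truncated exit time. -/
theorem exists_sum_increments_eq (m : ℝ≥0 → ℝ) (θ h : ℝ≥0) (j : ℕ) :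
    ∃ r, m 0 + ∑ k ∈ Finset.range j, (if k * h ≤ θ then m ((k + 1 : ℕ) * h) - m (k * h) else 0)
      = m r ∧ min (j * h) θ ≤ r ∧ r ≤ min (j * h) (θ + h) := by
  induction j with
  | zero => exact ⟨0, by simp⟩
  | succ j ih =>
    obtain ⟨r, hr, hr1, hr2⟩ := ih
    rw [Finset.sum_range_succ, ← add_assoc, hr]
    have hstep : ((j + 1 : ℕ) : ℝ≥0) * h = j * h + h := by push_cast; ring
    split_ifs with hj
    · have hrj : r = j * h :=
        le_antisymm (hr2.trans (min_le_left _ _)) (by rwa [min_eq_left hj] at hr1)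
      refine ⟨(j + 1 : ℕ) * h, by rw [hrj]; ring, min_le_left _ _, le_min le_rfl ?_⟩
      rw [hstep]
      gcongr
    · push Not at hj
      refine ⟨r, by ring, ?_, hr2.trans (min_le_min_right _ ?_)⟩
      · rw [min_eq_right hj.le] at hr1
        exact (min_le_right _ _).trans hr1
      · rw [hstep]; exact le_self_add

/-- Optional stopping at a bounded random time `θ` with `{t ≤ θ} ∈ 𝓕 t`. -/
theorem integral_stopped_eq [IsProbabilityMeasure P] {T : ℝ≥0} {C : ℝ}
    (hC : ∀ t ≤ T, ∀ ω, |M t ω| ≤ C) (hcont : ∀ ω, Continuous fun t => M t ω)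
    (hmeas : ∀ t ≤ T, AEStronglyMeasurable (M t) P)
    (hmart : ∀ s t, s ≤ t → t ≤ T → ∀ A, MeasurableSet[𝓕 s] A →
      ∫ ω in A, M t ω ∂P = ∫ ω in A, M s ω ∂P)
    {θ : Ω → ℝ≥0} (hθT : ∀ ω, θ ω ≤ T) (hθ : ∀ t ≤ T, MeasurableSet[𝓕 t] {ω | t ≤ θ ω}) :
    AEStronglyMeasurable (fun ω => M (θ ω) ω) P ∧ ∫ ω, M (θ ω) ω ∂P = ∫ ω, M 0 ω ∂P := by
  have hInt : ∀ t ≤ T, Integrable (M t) P := fun t ht =>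
    Integrable.of_bound (hmeas t ht) C (Eventually.of_forall (hC t ht))
  let h : ℕ → ℝ≥0 := fun N => T / (N + 1 : ℕ)
  have hh : ∀ N, ((N + 1 : ℕ) : ℝ≥0) * h N = T := fun N =>
    mul_div_cancel₀ T (Nat.cast_ne_zero.2 N.succ_ne_zero)
  have hle : ∀ N k : ℕ, k ≤ N + 1 → (k : ℝ≥0) * h N ≤ T := fun N k hk => by
    rw [← hh N]
    gcongr
  let A : ℕ → ℕ → Set Ω := fun N k => {ω | k * h N ≤ θ ω}
  have hA : ∀ N k : ℕ, k ≤ N + 1 → MeasurableSet[𝓕 (k * h N)] (A N k) := fun N k hk =>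
    hθ _ (hle N k hk)
  let I : ℕ → ℕ → Ω → ℝ := fun N k =>
    (A N k).indicator fun ω => M ((k + 1 : ℕ) * h N) ω - M (k * h N) ω
  let D : ℕ → Ω → ℝ := fun N ω => M 0 ω + ∑ k ∈ Finset.range (N + 1), I N k ω
  have hIint : ∀ N, ∀ k ∈ Finset.range (N + 1), Integrable (I N k) P := fun N k hk => by
    have hk' := Finset.mem_range.1 hk
    exact ((hInt _ (hle N _ hk')).sub (hInt _ (hle N k hk'.le))).indicator
      (𝓕.le _ _ (hA N k hk'.le))
  have hDint : ∀ N, Integrable (D N) P := fun N =>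
    (hInt 0 zero_le).add (integrable_finsetSum _ (hIint N))
  have hDval : ∀ N, ∫ ω, D N ω ∂P = ∫ ω, M 0 ω ∂P := by
    intro N
    rw [integral_add (hInt 0 zero_le) (integrable_finsetSum _ (hIint N)),
      integral_finsetSum _ (hIint N), Finset.sum_eq_zero, add_zero]
    intro k hk
    have hk' := Finset.mem_range.1 hk
    have h1 := hInt _ (hle N _ hk')
    have h2 := hInt _ (hle N k hk'.le)
    rw [integral_indicator (𝓕.le _ _ (hA N k hk'.le)),
      integral_sub h1.integrableOn h2.integrableOn, sub_eq_zero]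
    -- Each kept increment integrates to zero, since its event belongs to `𝓕` at the left endpoint.
    exact hmart _ _ (by gcongr; exact k.le_succ) (hle N _ hk') _ (hA N k hk'.le)
  have hDr : ∀ N ω, ∃ r, D N ω = M r ω ∧ θ ω ≤ r ∧ r ≤ T ∧ r ≤ θ ω + h N := by
    intro N ω
    obtain ⟨r, hr, hr1, hr2⟩ := exists_sum_increments_eq (fun t => M t ω) (θ ω) (h N) (N + 1)
    rw [hh N] at hr1 hr2
    rw [min_eq_right (hθT ω)] at hr1
    refine ⟨r, ?_, hr1, hr2.trans (min_le_left _ _), hr2.trans (min_le_right _ _)⟩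
    rw [← hr]
    simp only [D, I, A, Set.indicator_apply, Set.mem_ofPred_eq]
  choose r hr hr1 hr2 hr3 using hDr
  have hh0 : Tendsto h atTop (𝓝 0) := by
    have h1 : Tendsto (fun N : ℕ => ((N + 1 : ℕ) : ℝ≥0)) atTop atTop :=
      tendsto_natCast_atTop_atTop.comp (tendsto_add_atTop_nat 1)
    simpa [h, div_eq_mul_inv] using (tendsto_inv_atTop_zero.comp h1).const_mul T
  have hDlim : ∀ ω, Tendsto (fun N => D N ω) atTop (𝓝 (M (θ ω) ω)) := by
    intro ω
    simp only [hr]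
    refine ((hcont ω).tendsto (θ ω)).comp ?_
    refine tendsto_of_tendsto_of_tendsto_of_le_of_le tendsto_const_nhds ?_
      (fun N => hr1 N ω) (fun N => hr3 N ω)
    simpa using hh0.const_add (θ ω)
  refine ⟨aestronglyMeasurable_of_tendsto_ae atTop (fun N => (hDint N).aestronglyMeasurable)
    (Eventually.of_forall hDlim), ?_⟩
  have hlim := tendsto_integral_of_dominated_convergence (μ := P) (fun _ => C)
    (fun N => (hDint N).aestronglyMeasurable) (integrable_const C)
    (fun N => Eventually.of_forall fun ω => by rw [hr]; exact hC _ (hr2 N ω) ω)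
    (Eventually.of_forall hDlim)
  simp only [hDval] at hlim
  exact tendsto_nhds_unique hlim tendsto_const_nhds

/-! ### The mean exit time. -/

/-- Dynkin's formula at the exit time truncated at `T`. -/
theorem integral_truncated_exitTime {σ β f l : ℝ → ℝ} {x C : ℝ} [IsProbabilityMeasure P]
    (hX : SolvesMartingaleProblem σ β x P 𝓕 X) (hf : IsC1Solution σ β f l)
    (hl : ∀ y ∈ Set.Icc (0 : ℝ) 1, l y = -1) (hfC : ∀ y, |f y| ≤ C) (hlC : ∀ y, |l y| ≤ C)
    (hx : x ∈ Set.Icc (0 : ℝ) 1) (T : ℝ≥0) :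
    AEStronglyMeasurable (fun ω => f (X (min (T : ℝ≥0∞) (exitTime X ω)).toNNReal ω)) P ∧
      (∫⁻ ω, min (T : ℝ≥0∞) (exitTime X ω) ∂P).toReal
        = f x - ∫ ω, f (X (min (T : ℝ≥0∞) (exitTime X ω)).toNNReal ω) ∂P := by
  have hfc := hf.1.continuous
  have hlc := hf.2.1
  set θ : Ω → ℝ≥0 := fun ω => (min (T : ℝ≥0∞) (exitTime X ω)).toNNReal with hθdef
  have hθcoe : ∀ ω, (θ ω : ℝ≥0∞) = min (T : ℝ≥0∞) (exitTime X ω) := fun ω =>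
    ENNReal.coe_toNNReal (ne_top_of_le_ne_top ENNReal.coe_ne_top (min_le_left _ _))
  have hθT : ∀ ω, θ ω ≤ T := fun ω => by
    have := min_le_left (T : ℝ≥0∞) (exitTime X ω)
    rw [← hθcoe] at this
    exact_mod_cast this
  have hθm : Measurable θ :=
    (measurable_const.min (measurable_exitTime hX.adapted hX.continuous_paths)).ennreal_toNNReal
  -- For `t ≤ T` this is the complement of `{τ < t}`; no right-continuity of `𝓕` is needed.
  have hθ : ∀ t ≤ T, MeasurableSet[𝓕 t] {ω | t ≤ θ ω} := fun t ht => by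
    have : {ω | t ≤ θ ω} = {ω | exitTime X ω < t}ᶜ := by
      ext ω
      have h1 : (t : ℝ≥0∞) ≤ T := by exact_mod_cast ht
      rw [Set.mem_ofPred_eq, ← ENNReal.coe_le_coe, hθcoe, le_min_iff]
      simp [h1]
    rw [this]
    exact (measurableSet_exitTime_lt hX.adapted hX.continuous_paths t).compl
  set M : ℝ≥0 → Ω → ℝ := fun t ω => f (X t ω) - f x - ∫ s in (0 : ℝ)..t, l (X s.toNNReal ω) with hM
  have hpath : ∀ ω, Continuous fun s : ℝ => l (X s.toNNReal ω) := fun ω =>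
    hlc.comp ((hX.continuous_paths ω).comp continuous_real_toNNReal)
  have hMcont : ∀ ω, Continuous fun t => M t ω := fun ω => by
    have h1 : Continuous fun t : ℝ => ∫ s in (0 : ℝ)..t, l (X s.toNNReal ω) :=
      intervalIntegral.continuous_primitive (fun a b => (hpath ω).intervalIntegrable a b) 0
    exact ((hfc.comp (hX.continuous_paths ω)).sub continuous_const).sub
      (h1.comp NNReal.continuous_coe)
  have hMC : ∀ t ≤ T, ∀ ω, |M t ω| ≤ C + C + C * T := by
    intro t ht ω
    have h1 : ‖∫ s in (0 : ℝ)..t, l (X s.toNNReal ω)‖ ≤ C * |(t : ℝ) - 0| :=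
      intervalIntegral.norm_integral_le_of_norm_le_const fun s _ => hlC _
    rw [sub_zero, abs_of_nonneg t.coe_nonneg, Real.norm_eq_abs] at h1
    have hC0 : 0 ≤ C := (abs_nonneg _).trans (hfC 0)
    have h2 : C * (t : ℝ) ≤ C * T := by gcongr
    calc |M t ω| ≤ |f (X t ω) - f x| + |∫ s in (0 : ℝ)..t, l (X s.toNNReal ω)| := abs_sub _ _
      _ ≤ |f (X t ω)| + |f x| + |∫ s in (0 : ℝ)..t, l (X s.toNNReal ω)| := by
        gcongr; exact abs_sub _ _
      _ ≤ C + C + C * T := by linarith [hfC (X t ω), hfC x]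
  obtain ⟨hmeas, hmart⟩ := setIntegral_eq_of_locally_martingale (M := M)
    (hX.local_martingale f l hf) hMC
  obtain ⟨hθmeas, hθint⟩ := integral_stopped_eq hMC hMcont hmeas hmart hθT hθ
  have hM0 : ∫ ω, M 0 ω ∂P = 0 := by
    refine integral_eq_zero_of_ae ?_
    filter_upwards [hX.initial] with ω hω
    simp [hM, hω]
  have hMθ : ∀ᵐ ω ∂P, M (θ ω) ω = f (X (θ ω) ω) - f x + θ ω := by
    filter_upwards [hX.initial] with ω hω
    have h1 : ∫ s in (0 : ℝ)..θ ω, l (X s.toNNReal ω) = ∫ s in (0 : ℝ)..θ ω, (-1 : ℝ) := by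
      refine intervalIntegral.integral_congr fun s hs => ?_
      rw [Set.uIcc_of_le (θ ω).coe_nonneg] at hs
      refine hl _ (mem_Icc_of_le_exitTime (hX.continuous_paths ω) (by rwa [hω]) ?_)
      have h2 : s.toNNReal ≤ θ ω := Real.toNNReal_le_iff_le_coe.2 hs.2
      have h3 : (s.toNNReal : ℝ≥0∞) ≤ θ ω := by exact_mod_cast h2
      rw [hθcoe] at h3
      exact h3.trans (min_le_right _ _)
    simp only [hM, h1]
    simp
  have hθint' : Integrable (fun ω => (θ ω : ℝ)) P :=
    Integrable.of_bound hθm.coe_nnreal_real.aestronglyMeasurable (T : ℝ)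
      (Eventually.of_forall fun ω => by
        rw [Real.norm_eq_abs, abs_of_nonneg (θ ω).coe_nonneg]; exact_mod_cast hθT ω)
  -- Measurability is read off from that of the stopped martingale, as `f (X_θ) = M_θ + f x - θ`
  -- almost surely.
  have hfmeas : AEStronglyMeasurable (fun ω => f (X (θ ω) ω)) P := by
    refine ((hθmeas.add aestronglyMeasurable_const).sub hθint'.aestronglyMeasurable).congr
      (g := fun ω => f (X (θ ω) ω)) (f := fun ω => M (θ ω) ω + f x - θ ω) ?_
    filter_upwards [hMθ] with ω hω
    rw [hω]
    ring
  refine ⟨hfmeas, ?_⟩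
  have hfint : Integrable (fun ω => f (X (θ ω) ω)) P :=
    Integrable.of_bound hfmeas C (Eventually.of_forall fun ω => hfC _)
  have hlint : (∫⁻ ω, min (T : ℝ≥0∞) (exitTime X ω) ∂P).toReal = ∫ ω, (θ ω : ℝ) ∂P := by
    rw [integral_eq_lintegral_of_nonneg_ae (Eventually.of_forall fun ω => (θ ω).coe_nonneg)
      hθint'.aestronglyMeasurable]
    simp only [ENNReal.ofReal_coe_nnreal, hθcoe]
  have hfsub : Integrable (fun ω => f (X (θ ω) ω) - f x) P := hfint.sub (integrable_const _)
  rw [hM0, integral_congr_ae hMθ, integral_add hfsub hθint',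
    integral_sub hfint (integrable_const _)] at hθint
  simp only [integral_const, probReal_univ, one_smul] at hθint
  rw [hlint]
  linarith

/-- The mean exit time from `[0, 1]` is the value at the starting point of any bounded function
`f` in the domain of `L`, with `L f` bounded, that solves `L f = -1`, `f 0 = f 1 = 0`. -/
theorem lintegral_exitTime {σ β f l : ℝ → ℝ} {x C : ℝ} [IsProbabilityMeasure P]
    (hX : SolvesMartingaleProblem σ β x P 𝓕 X) (hf : IsC1Solution σ β f l)
    (hl : ∀ y ∈ Set.Icc (0 : ℝ) 1, l y = -1) (hf0 : f 0 = 0) (hf1 : f 1 = 0)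
    (hfC : ∀ y, |f y| ≤ C) (hlC : ∀ y, |l y| ≤ C) (hx : x ∈ Set.Icc (0 : ℝ) 1) :
    ∫⁻ ω, exitTime X ω ∂P < ∞ ∧ (∫⁻ ω, exitTime X ω ∂P).toReal = f x := by
  have hm := measurable_exitTime hX.adapted hX.continuous_paths
  have hdyn := fun n : ℕ => integral_truncated_exitTime hX hf hl hfC hlC hx n
  have hlim : Tendsto (fun n : ℕ => ∫⁻ ω, min ((n : ℝ≥0) : ℝ≥0∞) (exitTime X ω) ∂P) atTop
      (𝓝 (∫⁻ ω, exitTime X ω ∂P)) := by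
    refine lintegral_tendsto_of_tendsto_of_monotone
      (fun n => (measurable_const.min hm).aemeasurable)
      (Eventually.of_forall fun ω n k hnk => ?_) (Eventually.of_forall fun ω => ?_)
    · exact min_le_min_right _ (by exact_mod_cast hnk)
    · have h1 : Tendsto (fun n : ℕ => ((n : ℝ≥0) : ℝ≥0∞)) atTop (𝓝 ∞) := by
        simpa using ENNReal.tendsto_nat_nhds_top
      simpa using h1.min (tendsto_const_nhds (x := exitTime X ω))
  have hfin : ∀ n : ℕ, ∫⁻ ω, min ((n : ℝ≥0) : ℝ≥0∞) (exitTime X ω) ∂P ≠ ∞ := fun n => by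
    have : ∫⁻ ω, min ((n : ℝ≥0) : ℝ≥0∞) (exitTime X ω) ∂P ≤ ∫⁻ _, ((n : ℝ≥0) : ℝ≥0∞) ∂P :=
      lintegral_mono fun ω => min_le_left _ _
    refine ne_top_of_le_ne_top ?_ this
    simp
  have hle : ∫⁻ ω, exitTime X ω ∂P ≤ ENNReal.ofReal (C + C) := by
    refine le_of_tendsto' hlim fun n => ?_
    rw [← ENNReal.ofReal_toReal (hfin n), (hdyn n).2]
    refine ENNReal.ofReal_le_ofReal ?_
    have h1 : ‖∫ ω, f (X (min ((n : ℝ≥0) : ℝ≥0∞) (exitTime X ω)).toNNReal ω) ∂P‖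
        ≤ C * P.real Set.univ :=
      norm_integral_le_of_norm_le_const (Eventually.of_forall fun ω => hfC _)
    rw [probReal_univ, mul_one, Real.norm_eq_abs] at h1
    linarith [(abs_le.1 h1).1, (abs_le.1 (hfC x)).2]
  have hlt : ∫⁻ ω, exitTime X ω ∂P < ∞ := hle.trans_lt ENNReal.ofReal_lt_top
  refine ⟨hlt, ?_⟩
  -- The bound `E τ ≤ 2C` already gives `τ < ∞` almost surely; hence the integrand is eventually `f
  -- (X_τ) = 0`.
  have hfX : Tendsto (fun n : ℕ => ∫ ω, f (X (min ((n : ℝ≥0) : ℝ≥0∞) (exitTime X ω)).toNNReal ω)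
      ∂P) atTop (𝓝 (∫ _, (0 : ℝ) ∂P)) := by
    refine tendsto_integral_of_dominated_convergence (fun _ => C) (fun n => (hdyn n).1)
      (integrable_const C) (fun n => Eventually.of_forall fun ω => hfC _) ?_
    filter_upwards [ae_lt_top hm hlt.ne, hX.initial] with ω hω hω0
    refine tendsto_const_nhds.congr' ?_
    obtain ⟨k, hk⟩ := ENNReal.exists_nat_gt hω.ne
    filter_upwards [eventually_ge_atTop k] with n hn
    have h1 : exitTime X ω ≤ ((n : ℝ≥0) : ℝ≥0∞) :=
      hk.le.trans (by exact_mod_cast hn)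
    rw [min_eq_right h1]
    rcases eq_zero_or_one_at_exitTime (hX.continuous_paths ω) (by rwa [hω0])
      (ENNReal.coe_toNNReal hω.ne).symm with h | h
    · rw [h, hf0]
    · rw [h, hf1]
  have h1 := (ENNReal.tendsto_toReal hlt.ne).comp hlim
  have h2 : Tendsto (fun n : ℕ => (∫⁻ ω, min ((n : ℝ≥0) : ℝ≥0∞) (exitTime X ω) ∂P).toReal) atTop
      (𝓝 (f x)) := by
    simp only [fun n => (hdyn n).2]
    simpa using hfX.const_sub (f x)
  exact tendsto_nhds_unique h1 h2

end

end DistDrift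

theorem proposition4p1 (σ β : ℝ → ℝ) (hσ : Continuous σ) (hσ_pos : ∀ x, 0 < σ x)
    (hβ : Continuous β) (hS : ∃ S : ℝ → ℝ, DistDrift.IsSigma σ β S) :
    (∃! Γ : Set.Icc (0 : ℝ) 1 → ℝ, DistDrift.IsBVPSolution σ β 0 1 (fun _ => -1) 0 0 Γ) ∧
    ∀ Γ : Set.Icc (0 : ℝ) 1 → ℝ, DistDrift.IsBVPSolution σ β 0 1 (fun _ => -1) 0 0 Γ →
      ∀ (x : ℝ) (hx : x ∈ Set.Icc (0 : ℝ) 1)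
        (Ω : Type*) [mΩ : MeasurableSpace Ω] (P : Measure Ω) [IsProbabilityMeasure P]
        (𝓕 : Filtration ℝ≥0 mΩ) (X : ℝ≥0 → Ω → ℝ),
        DistDrift.SolvesMartingaleProblem σ β x P 𝓕 X →
          Measurable (DistDrift.exitTime X) ∧
          ∫⁻ ω, DistDrift.exitTime X ω ∂P < ∞ ∧
          (∀ᵐ ω ∂P, DistDrift.exitTime X ω < ∞) ∧
          (∫⁻ ω, DistDrift.exitTime X ω ∂P).toReal = Γ ⟨x, hx⟩ := by
  obtain ⟨S, hS⟩ := hS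
  have huniq := DistDrift.existsUnique_isBVPSolution hσ hσ_pos hβ hS
  refine ⟨huniq, fun Γ hΓ x hx Ω mΩ P _ 𝓕 X hX => ?_⟩
  obtain ⟨f, l, C, hf, hl, hf0, hf1, hfC, hlC⟩ :=
    DistDrift.exists_bounded_isC1Solution hσ hσ_pos hS
  -- The extension that comes with `Γ` may be unbounded on the line; uniqueness replaces it by the
  -- bounded `f`.
  have hΓf : Γ = fun y : Set.Icc (0 : ℝ) 1 => f y := huniq.unique hΓ
    ⟨f, l, hf.2.1, fun y => hl y y.2, fun _ => rfl, hf, hf0, hf1⟩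
  have hm := DistDrift.measurable_exitTime hX.adapted hX.continuous_paths
  obtain ⟨hlt, heq⟩ := DistDrift.lintegral_exitTime hX hf hl hf0 hf1 hfC hlC hx
  exact ⟨hm, hlt, ae_lt_top hm hlt.ne, heq.trans (by rw [hΓf])⟩
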